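/- There is an absolute constant $C_0>0$ such that the following holds for every constant $c_0>0$. Let $N\ge 2$, $0\le k\le N$ and $m$ be integers, let $\epsilon>0$ and $\sigma>0$, and let $\Phi$ be a real $m\times N$ matrix whose columns $\phi_1,\dots,\phi_N$ are unit vectors in the Euclidean norm. For $I\subset\{1,\dots,N\}$ let $\Phi_I$ be the submatrix of $\Phi$ formed of the columns with indices in $I$, and let $\|\Phi\|$ denote the Euclidean operator norm. Assume that $$k\le \frac{c_0N}{\|\Phi\|^2\log N},$$ and that, for $I$ drawn uniformly from the $k$-subsets of $\{1,\dots,N\}$, 1. ($(k,\frac12,\epsilon)$-StRIP) $\|\Phi_I^T\Phi_I-\mathrm{Id}\|\le \frac12$ with probability at least $1-\epsilon$; 2. ($(k,\frac{1}{128\log(N/(2\epsilon))},\epsilon)$-SINC) $\max_{i\notin I}\|\Phi_I^T\phi_i\|_2^2\le \frac{1}{128\log(N/(2\epsilon))}$ with probability at least $1-\epsilon$. Let $x\in\mathbb R^N$ be a random $k$-sparse signal from the generic random signal model: the set $I$ of locations of the $k$ coordinates of $x$ with largest magnitudes is uniformly distributed on the $k$-subsets of $\{1,\dots,N\}$ and,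 conditional on $I$, the signs of the coordinates $x_i$, $i\in I$, are i.i.d. uniform on $\{1,-1\}$ (the magnitudes are arbitrary). Let $y=\Phi x+z$, where $z$ is independent of $x$ and has i.i.d. Gaussian coordinates with mean $0$ and variance $\sigma^2$, and let $\hat x$ be a Lasso estimate, $$\hat x\in\arg\min_{u\in\mathbb R^N}\ \tfrac12\|\Phi u-y\|_2^2+\lambda\,\sigma\,\|u\|_1,\qquad \lambda=2\sqrt{2\log N}.$$ Then $$\|\Phi x-\Phi\hat x\|_2^2\le C_0\,k\,(\log N)\,\sigma^2$$ with probability at least $1-3\epsilon-\frac{1}{N\sqrt{2\pi\log N}}-N^{-a}$, where $a=0.15\log(2N/\epsilon)-1$. -/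

import Mathlib

open MeasureTheory ProbabilityTheory
open scoped Matrix Matrix.Norms.L2Operator

namespace SparseRecovery

/-- The submatrix `Φ_I` formed of the columns of `Φ` with indices in `I`. -/
def colSubmatrix {m N : ℕ} (Φ : Matrix (Fin m) (Fin N) ℝ) (I : Finset (Fin N)) :
    Matrix (Fin m) I ℝ :=
  Φ.submatrix id (fun i : I => (i : Fin N))

/-- All columns of `Φ` are unit vectors for the Euclidean norm. -/
def UnitColumns {m N : ℕ} (Φ : Matrix (Fin m) (Fin N) ℝ) : Prop :=
  ∀ i : Fin N, ‖WithLp.toLp 2 (Φ.col i)‖ = 1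

open Classical in
/-- The probability of the event `A` under the uniform distribution on the `k`-subsets
of the index set `Fin N` (used only for `k ≤ N`). -/
noncomputable def uniformSubsetProb (N k : ℕ) (A : Finset (Fin N) → Prop) : ℝ :=
  (((Finset.univ : Finset (Fin N)).powersetCard k).filter A).card / (N.choose k : ℝ)

/-- The statistical restricted isometry property `(k, δ, ε)`-StRIP. The matrix norm is the
Euclidean operator norm. -/
def IsStRIP {m N : ℕ} (Φ : Matrix (Fin m) (Fin N) ℝ) (k : ℕ) (δ ε : ℝ) : Prop :=
  1 - ε ≤ uniformSubsetProb N k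
    (fun I => ‖(colSubmatrix Φ I)ᵀ * colSubmatrix Φ I - 1‖ ≤ δ)

/-- The statistical incoherence condition `(k, α, ε)`-SINC. -/
def IsSINC {m N : ℕ} (Φ : Matrix (Fin m) (Fin N) ℝ) (k : ℕ) (α ε : ℝ) : Prop :=
  1 - ε ≤ uniformSubsetProb N k
    (fun I => ∀ i : Fin N, i ∉ I →
      ‖WithLp.toLp 2 ((colSubmatrix Φ I)ᵀ *ᵥ Φ.col i)‖ ^ 2 ≤ α)

/-- `I` is a set of locations of `k` coordinates of `x` with largest magnitudes. -/
def IsLargestCoords {N : ℕ} (k : ℕ) (x : Fin N → ℝ) (I : Finset (Fin N)) : Prop :=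
  I.card = k ∧ ∀ i ∈ I, ∀ j, j ∉ I → |x j| ≤ |x i|

/-- The random vector `x` is drawn from the generic random signal model `S_k`: the set `I` of
locations of its `k` largest coordinates is uniform on the `k`-subsets, and, conditional on
`I = J`, the signs of the coordinates `x i`, `i ∈ J`, are i.i.d. uniform on `{1, -1}` (each
pattern of `k` signs has conditional probability `2⁻ᵏ`). Nothing is assumed on the magnitudes,
which may depend on the set `I` and on the signs. -/
structure IsGenericSignal {Ω : Type*} [MeasurableSpace Ω] (P : Measure Ω) {N : ℕ} (k : ℕ)
    (x : Ω → Fin N → ℝ) : Prop where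
  measurable : Measurable x
  exists_support : ∃ I : Ω → Finset (Fin N),
    (∀ J, MeasurableSet {ω | I ω = J}) ∧
    (∀ᵐ ω ∂P, IsLargestCoords k (x ω) (I ω)) ∧
    (∀ J : Finset (Fin N), J.card = k → P.real {ω | I ω = J} = 1 / (N.choose k : ℝ)) ∧
    (∀ J : Finset (Fin N), J.card = k →
      ∀ s : Fin N → ℝ, (∀ i, s i = 1 ∨ s i = -1) →
        (P[|{ω | I ω = J}]).real {ω | ∀ i ∈ J, Real.sign (x ω i) = s i} = 1 / 2 ^ k)

/-- `x` is `k`-sparse: it has at most `k` nonzero coordinates. -/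
def IsSparse {N : ℕ} (k : ℕ) (x : Fin N → ℝ) : Prop :=
  {i | x i ≠ 0}.ncard ≤ k

/-- The coordinates of `z` are i.i.d. Gaussian with mean zero and variance `σ ^ 2`. -/
structure IsGaussianNoise {Ω : Type*} [MeasurableSpace Ω] (P : Measure Ω) {m : ℕ} (σ : ℝ)
    (z : Ω → Fin m → ℝ) : Prop where
  measurable : Measurable z
  indep : iIndepFun (fun (j : Fin m) ω => z ω j) P
  law : ∀ j, P.map (fun ω => z ω j) = gaussianReal 0 (σ ^ 2).toNNReal

/-- The Lasso objective `½ ‖Φ u - y‖₂² + τ ‖u‖₁` with penalty weight `τ`. -/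
noncomputable def lassoObjective {m N : ℕ} (Φ : Matrix (Fin m) (Fin N) ℝ) (τ : ℝ)
    (y : Fin m → ℝ) (u : Fin N → ℝ) : ℝ :=
  1 / 2 * ‖WithLp.toLp 2 (Φ *ᵥ u - y)‖ ^ 2 + τ * ∑ i, |u i|

/-- `u` is a Lasso estimate from the observation `y`, with penalty weight `τ`. -/
def IsLassoEstimate {m N : ℕ} (Φ : Matrix (Fin m) (Fin N) ℝ) (τ : ℝ)
    (y : Fin m → ℝ) (u : Fin N → ℝ) : Prop :=
  ∀ v : Fin N → ℝ, lassoObjective Φ τ y u ≤ lassoObjective Φ τ y v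

end SparseRecovery

namespace SparseRecovery

/-! Fix a support `J` satisfying both StRIP and SINC. Each column off `J` splits into its projection
`Φ *ᵥ w i` on the span of the columns in `J` and an orthogonal residual; StRIP and SINC make `w i`
short. Accordingly the Lasso error image is `Φ *ᵥ g + r`, with `g` supported on `J` and `r`
orthogonal to `Φ *ᵥ g`. Comparing the Lasso objective at the estimate and at `x`, the off-support
terms are absorbed by the ℓ¹ penalty once residual noise plus `τ * |w i ⬝ᵥ sign x|` is at most `τ`.
What is left is linear in `g`, and StRIP bounds `g` by the prediction error itself
(`IsLassoEstimate.prediction_bound`).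

The conditions used involve only the support, the signs and the noise, so the magnitudes are
irrelevant. Hoeffding over the signs costs `ε`, a union bound over `N` Gaussian functionals costs `1
/ (N * √(2 * π * log N))`, and the choice of support costs `2 * ε`. `prob_good_pairs_ge` combines
these using independence of signal and noise. The term `N ^ (-a)` serves only to make the claim
trivial when `a ≤ 0`; the constants of the Hoeffding step need `a > 0`. -/

theorem norm_toLp_sq {ι : Type*} [Fintype ι] (v : ι → ℝ) : ‖WithLp.toLp 2 v‖ ^ 2 = v ⬝ᵥ v := by
  rw [EuclideanSpace.norm_sq_eq]
  simp [dotProduct, sq]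

theorem dotProduct_sq_le {ι : Type*} [Fintype ι] (v w : ι → ℝ) :
    (v ⬝ᵥ w) ^ 2 ≤ (v ⬝ᵥ v) * (w ⬝ᵥ w) := by
  simpa [dotProduct, sq] using Finset.sum_mul_sq_le_sq_mul_sq Finset.univ v w

/-! ### Restricted isometry and projection on the columns in `J` -/

/-- A Gram matrix within `1 / 2` of the identity is invertible with controlled inverse. -/
theorem exists_gram_mulVec_eq {ι κ : Type*} [Fintype ι] [Fintype κ] [DecidableEq κ]
    (A : Matrix ι κ ℝ) (hA : ‖Aᵀ * A - 1‖ ≤ 1 / 2) :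
    (∀ v : κ → ℝ, v ⬝ᵥ v ≤ 2 * ((A *ᵥ v) ⬝ᵥ (A *ᵥ v))) ∧
      ∀ b : κ → ℝ, ∃ w : κ → ℝ, Aᵀ *ᵥ (A *ᵥ w) = b ∧ w ⬝ᵥ w ≤ 4 * (b ⬝ᵥ b) := by
  have key (v : κ → ℝ) : ‖WithLp.toLp 2 (Aᵀ *ᵥ (A *ᵥ v)) - WithLp.toLp 2 v‖ ≤
      1 / 2 * ‖WithLp.toLp 2 v‖ := by
    have h := Matrix.l2_opNorm_mulVec (Aᵀ * A - 1) (WithLp.toLp 2 v)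
    have h' : ‖WithLp.toLp 2 ((Aᵀ * A - 1) *ᵥ v)‖ ≤ 1 / 2 * ‖WithLp.toLp 2 v‖ :=
      h.trans (by gcongr)
    rwa [Matrix.sub_mulVec, Matrix.one_mulVec, ← Matrix.mulVec_mulVec, WithLp.toLp_sub] at h'
  -- The reverse triangle inequality gives `‖v‖ ≤ 2 ‖AᵀAv‖`: this yields both injectivity, hence
  -- solvability in finite dimension, and the bound on the solution.
  have lower (v : κ → ℝ) : v ⬝ᵥ v ≤ 4 * ((Aᵀ *ᵥ (A *ᵥ v)) ⬝ᵥ (Aᵀ *ᵥ (A *ᵥ v))) := by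
    have h1 := norm_sub_norm_le (WithLp.toLp 2 v) (WithLp.toLp 2 (Aᵀ *ᵥ (A *ᵥ v)))
    rw [norm_sub_rev] at h1
    rw [← norm_toLp_sq, ← norm_toLp_sq]
    nlinarith [key v, norm_nonneg (WithLp.toLp 2 v),
      norm_nonneg (WithLp.toLp 2 (Aᵀ *ᵥ (A *ᵥ v)))]
  refine ⟨fun v => ?_, fun b => ?_⟩
  · have h1 : (A *ᵥ v) ⬝ᵥ (A *ᵥ v) = v ⬝ᵥ (Aᵀ *ᵥ (A *ᵥ v)) := by
      rw [Matrix.dotProduct_mulVec v, Matrix.vecMul_transpose]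
    have h2 := dotProduct_sq_le v (Aᵀ *ᵥ (A *ᵥ v) - v)
    have h3 := key v
    rw [← WithLp.toLp_sub] at h3
    have h4 : (Aᵀ *ᵥ (A *ᵥ v) - v) ⬝ᵥ (Aᵀ *ᵥ (A *ᵥ v) - v) ≤ 1 / 4 * (v ⬝ᵥ v) := by
      rw [← norm_toLp_sq, ← norm_toLp_sq]
      nlinarith [norm_nonneg (WithLp.toLp 2 v),
        norm_nonneg (WithLp.toLp 2 (Aᵀ *ᵥ (A *ᵥ v) - v))]
    have h5 : 0 ≤ v ⬝ᵥ v := by rw [← norm_toLp_sq]; positivity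
    have h6 : (v ⬝ᵥ (Aᵀ *ᵥ (A *ᵥ v) - v)) ^ 2 ≤ (1 / 2 * (v ⬝ᵥ v)) ^ 2 := by nlinarith
    have h7 := abs_le_of_sq_le_sq' h6 (by positivity)
    rw [dotProduct_sub] at h7
    rw [h1]
    linarith [h7.1]
  · have hinj : Function.Injective (Aᵀ * A).mulVecLin := by
      rw [← LinearMap.ker_eq_bot, LinearMap.ker_eq_bot']
      intro v hv
      have hv' : Aᵀ *ᵥ (A *ᵥ v) = 0 := by rw [← hv, Matrix.mulVec_mulVec]; rfl
      have h := lower v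
      rw [hv', ← norm_toLp_sq] at h
      have h0 : ‖WithLp.toLp 2 v‖ = 0 := by
        have : ‖WithLp.toLp 2 v‖ ^ 2 = 0 := le_antisymm (by simpa using h) (by positivity)
        simpa using this
      simpa using h0
    obtain ⟨w, hw⟩ := LinearMap.injective_iff_surjective.mp hinj b
    have hw' : Aᵀ *ᵥ (A *ᵥ w) = b := by rw [← hw, Matrix.mulVec_mulVec]; rfl
    exact ⟨w, hw', by simpa [hw'] using lower w⟩

/-- Coefficient vectors are kept on all of `Fin N`, vanishing off `J`; this passes to the subtype
where the Gram bounds live. -/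
theorem mulVec_extend {m N : ℕ} (Φ : Matrix (Fin m) (Fin N) ℝ) (J : Finset (Fin N))
    (g : Fin N → ℝ) (hg : ∀ i ∉ J, g i = 0) :
    Φ *ᵥ g = colSubmatrix Φ J *ᵥ (fun i : J => g i) := by
  ext a
  simp only [Matrix.mulVec, dotProduct, colSubmatrix, Matrix.submatrix_apply, id]
  rw [Finset.sum_coe_sort J (fun i => Φ a i * g i)]
  refine (Finset.sum_subset (Finset.subset_univ J) fun i _ hi => ?_).symm
  simp [hg i hi]

theorem dotProduct_extend {N : ℕ} (J : Finset (Fin N)) (g f : Fin N → ℝ)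
    (hg : ∀ i ∉ J, g i = 0) :
    g ⬝ᵥ f = (fun i : J => g i) ⬝ᵥ (fun i : J => f i) := by
  simp only [dotProduct]
  rw [Finset.sum_coe_sort J (fun i => g i * f i)]
  refine (Finset.sum_subset (Finset.subset_univ J) fun i _ hi => ?_).symm
  simp [hg i hi]

/-- The restricted isometry condition at `J` gives a lower bound for `Φ` on the vectors supported
on `J`, and lets one project any vector on the span of the columns with indices in `J`. -/
theorem exists_projection_coeffs {m N : ℕ} (Φ : Matrix (Fin m) (Fin N) ℝ) (J : Finset (Fin N))
    (hJ : ‖(colSubmatrix Φ J)ᵀ * colSubmatrix Φ J - 1‖ ≤ 1 / 2) :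
    (∀ g : Fin N → ℝ, (∀ i ∉ J, g i = 0) → g ⬝ᵥ g ≤ 2 * ((Φ *ᵥ g) ⬝ᵥ (Φ *ᵥ g))) ∧
      ∀ f : Fin m → ℝ, ∃ w : Fin N → ℝ, (∀ i ∉ J, w i = 0) ∧
        (∀ j ∈ J, Φ.col j ⬝ᵥ (f - Φ *ᵥ w) = 0) ∧
        w ⬝ᵥ w ≤ 4 * ‖WithLp.toLp 2 ((colSubmatrix Φ J)ᵀ *ᵥ f)‖ ^ 2 := by
  obtain ⟨h1, h2⟩ := exists_gram_mulVec_eq (colSubmatrix Φ J) hJ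
  refine ⟨fun g hg => ?_, fun f => ?_⟩
  · rw [mulVec_extend Φ J g hg, dotProduct_extend J g g hg]
    exact h1 _
  · obtain ⟨w, hw, hw'⟩ := h2 ((colSubmatrix Φ J)ᵀ *ᵥ f)
    set w' : Fin N → ℝ := fun i => if h : i ∈ J then w ⟨i, h⟩ else 0 with hw'def
    have hsupp : ∀ i ∉ J, w' i = 0 := fun i hi => by simp [hw'def, hi]
    have hres : (fun i : J => w' i) = w := by ext i; simp [hw'def]
    refine ⟨w', hsupp, fun j hj => ?_, ?_⟩
    · rw [mulVec_extend Φ J w' hsupp, hres, dotProduct_sub, sub_eq_zero]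
      exact (congrFun hw ⟨j, hj⟩).symm
    · rw [dotProduct_extend J w' w' hsupp, hres, norm_toLp_sq]
      exact hw'

theorem mulVec_dotProduct_eq_zero {m N : ℕ} (Φ : Matrix (Fin m) (Fin N) ℝ) (J : Finset (Fin N))
    (g : Fin N → ℝ) (hg : ∀ i ∉ J, g i = 0) (q : Fin m → ℝ)
    (hq : ∀ j ∈ J, Φ.col j ⬝ᵥ q = 0) : (Φ *ᵥ g) ⬝ᵥ q = 0 := by
  rw [← Matrix.vecMul_transpose, ← Matrix.dotProduct_mulVec]
  refine Finset.sum_eq_zero fun i _ => ?_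
  by_cases hi : i ∈ J
  · have : (Φᵀ *ᵥ q) i = 0 := hq i hi
    simp [this]
  · simp [hg i hi]

/-- Pythagoras: the residual is orthogonal to `Φ *ᵥ w`. -/
theorem residual_dotProduct_self_le {m N : ℕ} (Φ : Matrix (Fin m) (Fin N) ℝ)
    (J : Finset (Fin N)) (f : Fin m → ℝ) (w : Fin N → ℝ) (hw : ∀ i ∉ J, w i = 0)
    (hq : ∀ j ∈ J, Φ.col j ⬝ᵥ (f - Φ *ᵥ w) = 0) :
    (f - Φ *ᵥ w) ⬝ᵥ (f - Φ *ᵥ w) ≤ f ⬝ᵥ f := by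
  have h := mulVec_dotProduct_eq_zero Φ J w hw _ hq
  have h1 : 0 ≤ (Φ *ᵥ w) ⬝ᵥ (Φ *ᵥ w) := by rw [← norm_toLp_sq]; positivity
  have h2 := dotProduct_comm (Φ *ᵥ w) f
  simp only [dotProduct_sub, sub_dotProduct] at h ⊢
  linarith

/-! ### Deterministic analysis of the Lasso -/

/-- Convexity: `Real.sign a` is a subgradient of the absolute value at `a`. -/
theorem abs_sub_abs_le_sign_mul (a b : ℝ) : |a| - |b| ≤ -(Real.sign a * (b - a)) := by
  rcases lt_trichotomy a 0 with h | h | h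
  · rw [Real.sign_of_neg h, abs_of_neg h]; linarith [neg_abs_le b]
  · simp [h]
  · rw [Real.sign_of_pos h, abs_of_pos h]; linarith [le_abs_self b]

/-- The deterministic prediction bound for the Lasso, under the dual certificate conditions. -/
theorem IsLassoEstimate.prediction_bound {m N : ℕ} {Φ : Matrix (Fin m) (Fin N) ℝ}
    {τ T : ℝ} {x u : Fin N → ℝ} {z : Fin m → ℝ} (hτ : 0 ≤ τ)
    (hu : IsLassoEstimate Φ τ (Φ *ᵥ x + z) u) (J : Finset (Fin N))
    (hx : ∀ i ∉ J, x i = 0)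
    (hres : ∀ g : Fin N → ℝ, (∀ i ∉ J, g i = 0) → g ⬝ᵥ g ≤ 2 * ((Φ *ᵥ g) ⬝ᵥ (Φ *ᵥ g)))
    (w : Fin N → Fin N → ℝ) (hw : ∀ i, ∀ j ∉ J, w i j = 0)
    (hq : ∀ i, ∀ j ∈ J, Φ.col j ⬝ᵥ (Φ.col i - Φ *ᵥ w i) = 0)
    (hin : ∀ j ∈ J, |Φ.col j ⬝ᵥ z| ≤ T)
    (hout : ∀ i ∉ J, |(Φ.col i - Φ *ᵥ w i) ⬝ᵥ z| +
      τ * |w i ⬝ᵥ (fun j => Real.sign (x j))| ≤ τ) :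
    ‖WithLp.toLp 2 (Φ *ᵥ x - Φ *ᵥ u)‖ ^ 2 ≤ 8 * J.card * (T + τ) ^ 2 := by
  classical
  set s : Fin N → ℝ := fun j => Real.sign (x j) with hs
  set h : Fin N → ℝ := u - x with hh
  set hO : Fin N → ℝ := fun i => if i ∈ J then 0 else h i with hhO
  set hI : Fin N → ℝ := fun i => if i ∈ J then h i else 0 with hhI
  -- Moves the projected off-support error onto `J`; `r` below collects the orthogonal residuals.
  set c : Fin N → ℝ := ∑ i, hO i • w i with hc
  set g : Fin N → ℝ := hI + c with hg
  set r : Fin m → ℝ := ∑ i, hO i • (Φ.col i - Φ *ᵥ w i) with hr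
  have hgs : ∀ i ∉ J, g i = 0 := by
    intro i hi
    simp [hg, hc, hhI, hi, Finset.sum_apply, hw _ i hi]
  have hcol (v : Fin N → ℝ) : Φ *ᵥ v = ∑ i, v i • Φ.col i := by
    ext a; simp [Matrix.mulVec, dotProduct, mul_comm]
  have hsplit : Φ *ᵥ h = Φ *ᵥ g + r := by
    have e1 : Φ *ᵥ c = ∑ i, hO i • (Φ *ᵥ w i) := by
      rw [hc, Matrix.mulVec_sum]; simp [Matrix.mulVec_smul]
    have e2 : h = hI + hO := by ext i; by_cases hi : i ∈ J <;> simp [hhI, hhO, hi]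
    rw [hg, Matrix.mulVec_add, e1, hr]
    simp only [smul_sub, Finset.sum_sub_distrib]
    rw [← hcol hO]
    conv_lhs => rw [e2, Matrix.mulVec_add]
    abel
  have horth : (Φ *ᵥ g) ⬝ᵥ r = 0 := by
    refine mulVec_dotProduct_eq_zero Φ J g hgs r fun j hj => ?_
    rw [hr, dotProduct_sum]
    exact Finset.sum_eq_zero fun i _ => by rw [dotProduct_smul, hq i j hj, smul_zero]
  set D : ℝ := (Φ *ᵥ h) ⬝ᵥ (Φ *ᵥ h) with hD
  -- By Pythagoras `‖Φ g‖² ≤ D`, and the restricted isometry applies to `g`.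
  have hgD : g ⬝ᵥ g ≤ 2 * D := by
    have h1 := hres g hgs
    have h2 : 0 ≤ r ⬝ᵥ r := by rw [← norm_toLp_sq]; positivity
    have h3 := dotProduct_comm (Φ *ᵥ g) r
    rw [hD, hsplit]
    simp only [dotProduct_add, add_dotProduct]
    linarith
  have hopt : 1 / 2 * D ≤ (Φ *ᵥ h) ⬝ᵥ z + τ * ∑ i, (|x i| - |u i|) := by
    have h1 := hu x
    simp only [lassoObjective, norm_toLp_sq] at h1
    have e1 : Φ *ᵥ u - (Φ *ᵥ x + z) = Φ *ᵥ h - z := by rw [hh, Matrix.mulVec_sub]; abel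
    have e2 : Φ *ᵥ x - (Φ *ᵥ x + z) = -z := by abel
    rw [e1, e2] at h1
    have h3 := dotProduct_comm (Φ *ᵥ h) z
    simp only [dotProduct_sub, sub_dotProduct, neg_dotProduct, dotProduct_neg, neg_neg] at h1
    rw [Finset.sum_sub_distrib]
    linarith
  have hl1 : ∑ i, (|x i| - |u i|) ≤ -(hI ⬝ᵥ s) - ∑ i, |hO i| := by
    rw [dotProduct, ← Finset.sum_neg_distrib, ← Finset.sum_sub_distrib]
    refine Finset.sum_le_sum fun i _ => ?_
    by_cases hi : i ∈ J
    · have := abs_sub_abs_le_sign_mul (x i) (u i)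
      simp only [hhI, hhO, hi, if_true, hs, hh, Pi.sub_apply, abs_zero]
      linarith
    · simp [hhI, hhO, hi, hx i hi, hh]
  have hIs : hI ⬝ᵥ s = g ⬝ᵥ s - ∑ i, hO i * (w i ⬝ᵥ s) := by
    simp [hg, hc, add_dotProduct, sum_dotProduct, smul_dotProduct]
  have hz : (Φ *ᵥ h) ⬝ᵥ z = g ⬝ᵥ (Φᵀ *ᵥ z) + ∑ i, hO i * ((Φ.col i - Φ *ᵥ w i) ⬝ᵥ z) := by
    rw [hsplit, add_dotProduct, hr, sum_dotProduct, Matrix.dotProduct_mulVec,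
      Matrix.vecMul_transpose]
    simp [smul_dotProduct]
  -- The certificate condition `hout`, weighted by `|hO i|`, cancels every off-support contribution.
  have hrest : ∑ i, hO i * ((Φ.col i - Φ *ᵥ w i) ⬝ᵥ z) + τ * ∑ i, hO i * (w i ⬝ᵥ s)
      ≤ τ * ∑ i, |hO i| := by
    rw [Finset.mul_sum, Finset.mul_sum, ← Finset.sum_add_distrib]
    refine Finset.sum_le_sum fun i _ => ?_
    by_cases hi : i ∈ J
    · simp [hhO, hi]
    · have h1 := hout i hi
      have h2 : hO i * ((Φ.col i - Φ *ᵥ w i) ⬝ᵥ z) ≤ |hO i| * |(Φ.col i - Φ *ᵥ w i) ⬝ᵥ z| := by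
        rw [← abs_mul]; exact le_abs_self _
      have h3 : hO i * (w i ⬝ᵥ s) ≤ |hO i| * |w i ⬝ᵥ s| := by
        rw [← abs_mul]; exact le_abs_self _
      nlinarith [abs_nonneg (hO i), mul_le_mul_of_nonneg_left h3 hτ,
        mul_le_mul_of_nonneg_left h1 (abs_nonneg (hO i))]
  set v : Fin N → ℝ := fun i => if i ∈ J then (Φᵀ *ᵥ z - τ • s) i else 0 with hv
  have hgv : g ⬝ᵥ v = g ⬝ᵥ (Φᵀ *ᵥ z) - τ * (g ⬝ᵥ s) := by
    rw [← smul_eq_mul, ← dotProduct_smul, ← dotProduct_sub]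
    refine Finset.sum_congr rfl fun i _ => ?_
    by_cases hi : i ∈ J
    · simp [hv, hi]
    · simp [hgs i hi]
  have hvv : v ⬝ᵥ v ≤ J.card * (T + τ) ^ 2 := by
    have hle : ∀ i, v i * v i ≤ if i ∈ J then (T + τ) ^ 2 else 0 := by
      intro i
      by_cases hi : i ∈ J
      · have h1 : |(Φᵀ *ᵥ z) i| ≤ T := hin i hi
        have h2 : |s i| ≤ 1 := by
          rcases Real.sign_apply_eq (x i) with h | h | h <;> simp [hs, h]
        have h3 : |(Φᵀ *ᵥ z - τ • s) i| ≤ T + τ := by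
          refine (abs_sub _ _).trans (add_le_add h1 ?_)
          rw [Pi.smul_apply, smul_eq_mul, abs_mul, abs_of_nonneg hτ]
          exact mul_le_of_le_one_right hτ h2
        simp only [hv, hi, if_true]
        rw [← sq, ← sq_abs]
        gcongr
      · simp [hv, hi]
    refine (Finset.sum_le_sum fun i _ => hle i).trans_eq ?_
    simp
  have hfin : 1 / 2 * D ≤ g ⬝ᵥ v := by
    have := mul_le_mul_of_nonneg_left hl1 hτ
    rw [hgv]
    rw [hIs] at this
    linarith
  have hD0 : 0 ≤ D := by rw [hD, ← norm_toLp_sq]; positivity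
  have hvv0 : 0 ≤ v ⬝ᵥ v := by rw [← norm_toLp_sq]; positivity
  have hsq : (1 / 2 * D) ^ 2 ≤ 2 * D * (v ⬝ᵥ v) :=
    (pow_le_pow_left₀ (by positivity) hfin 2).trans
      ((dotProduct_sq_le g v).trans (by gcongr))
  -- Divide `D² / 4 ≤ 2 D ‖v‖²` by `D`, when `D > 0`.
  have hDv : D ≤ 8 * (v ⬝ᵥ v) := by
    by_contra! hcon
    have : 0 < D := by linarith
    nlinarith
  have e : Φ *ᵥ x - Φ *ᵥ u = -(Φ *ᵥ h) := by rw [hh, Matrix.mulVec_sub]; abel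
  rw [norm_toLp_sq, e, neg_dotProduct, dotProduct_neg, neg_neg, mul_assoc]
  linarith

/-! ### Gaussian tails -/

/-- Mills' bound for the upper tail of the standard Gaussian distribution. -/
theorem gaussianReal_Ioi_le {t : ℝ} (ht : 0 < t) :
    (gaussianReal 0 1).real (Set.Ioi t) ≤ Real.exp (-t ^ 2 / 2) / (t * √(2 * Real.pi)) := by
  -- On `x > t` the density is at most `x / t` times itself, which has an explicit antiderivative.
  set c : ℝ := (t * √(2 * Real.pi))⁻¹ with hc
  have hc0 : 0 ≤ c := by positivity
  have hderiv (x : ℝ) : HasDerivAt (fun y => -c * Real.exp (-(1 / 2) * y ^ 2))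
      (c * (x * Real.exp (-(1 / 2) * x ^ 2))) x := by
    convert! (((hasDerivAt_pow 2 x).const_mul (-(1 / 2) : ℝ)).exp).const_mul (-c) using 1
    norm_num
    left
    ring
  have hlim : Filter.Tendsto (fun y : ℝ => -c * Real.exp (-(1 / 2) * y ^ 2)) Filter.atTop
      (nhds 0) := by
    rw [← mul_zero (-c)]
    refine Filter.Tendsto.const_mul _ (Real.tendsto_exp_atBot.comp ?_)
    exact (Filter.tendsto_pow_atTop two_ne_zero).const_mul_atTop_of_neg (by norm_num)
  have hint : Integrable fun x : ℝ => c * (x * Real.exp (-(1 / 2) * x ^ 2)) :=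
    (integrable_mul_exp_neg_mul_sq (by norm_num)).const_mul c
  have hI := integral_Ioi_of_hasDerivAt_of_tendsto' (a := t) (fun x _ => hderiv x)
    hint.integrableOn hlim
  rw [measureReal_def, gaussianReal_apply_eq_integral 0 one_ne_zero,
    ENNReal.toReal_ofReal (integral_nonneg fun x => gaussianPDFReal_nonneg _ _ _)]
  have hle : ∫ x in Set.Ioi t, gaussianPDFReal 0 1 x ≤
      ∫ x in Set.Ioi t, c * (x * Real.exp (-(1 / 2) * x ^ 2)) := by
    refine setIntegral_mono_on (integrable_gaussianPDFReal 0 1).integrableOn hint.integrableOn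
      measurableSet_Ioi fun x hx => ?_
    have hx' : t < x := hx
    have e : gaussianPDFReal 0 1 x = (√(2 * Real.pi))⁻¹ * Real.exp (-(1 / 2) * x ^ 2) := by
      simp only [gaussianPDFReal, NNReal.coe_one, mul_one, sub_zero]
      congr 2; ring
    rw [e, ← mul_assoc]
    gcongr
    rw [hc, mul_inv, mul_comm t⁻¹, mul_assoc]
    refine le_mul_of_one_le_right (by positivity) ?_
    rw [inv_mul_eq_div, one_le_div ht]
    exact hx'.le
  refine hle.trans_eq ?_
  rw [hI, hc, div_eq_inv_mul]
  ring_nf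

theorem gaussianReal_abs_tail_le {t : ℝ} (ht : 0 < t) :
    (gaussianReal 0 1).real {y | t < |y|} ≤
      2 * (Real.exp (-t ^ 2 / 2) / (t * √(2 * Real.pi))) := by
  have hset : {y : ℝ | t < |y|} = Set.Ioi t ∪ (fun y => -y) ⁻¹' Set.Ioi t := by
    ext y; simp [lt_abs, lt_neg]
  have hneg : (gaussianReal 0 1).real ((fun y => -y) ⁻¹' Set.Ioi t) =
      (gaussianReal 0 1).real (Set.Ioi t) := by
    rw [← map_measureReal_apply measurable_neg measurableSet_Ioi, gaussianReal_map_neg, neg_zero]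
  rw [hset, two_mul]
  refine (measureReal_union_le _ _).trans ?_
  rw [hneg]
  exact add_le_add (gaussianReal_Ioi_le ht) (gaussianReal_Ioi_le ht)

theorem measurable_dotProduct {ι : Type*} [Fintype ι] (q : ι → ℝ) :
    Measurable fun v : ι → ℝ => q ⬝ᵥ v :=
  (by simp only [dotProduct]; fun_prop : Continuous fun v : ι → ℝ => q ⬝ᵥ v).measurable

/-- A linear functional of Gaussian noise is Gaussian. -/
theorem IsGaussianNoise.map_dotProduct {Ω : Type*} [MeasurableSpace Ω] {P : Measure Ω}
    [IsProbabilityMeasure P] {m : ℕ} {σ : ℝ} {z : Ω → Fin m → ℝ} (hz : IsGaussianNoise P σ z)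
    (q : Fin m → ℝ) :
    P.map (fun ω => q ⬝ᵥ z ω) = (gaussianReal 0 1).map (σ * √(q ⬝ᵥ q) * ·) := by
  have hzj (j : Fin m) : Measurable fun ω => z ω j := (measurable_pi_apply j).comp hz.measurable
  have hlaw (j : Fin m) : P.map (fun ω => q j * z ω j) =
      gaussianReal 0 (.mk (q j ^ 2) (sq_nonneg _) * (σ ^ 2).toNNReal) := by
    have h := Measure.map_map (μ := P) (measurable_const_mul (q j)) (hzj j)
    rw [hz.law j, gaussianReal_map_const_mul, mul_zero] at h
    exact h.symm
  have hind : iIndepFun (fun (j : Fin m) ω => q j * z ω j) P :=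
    hz.indep.comp (fun j y => q j * y) fun j => measurable_const_mul (q j)
  have hq0 : 0 ≤ q ⬝ᵥ q := by rw [← norm_toLp_sq]; positivity
  have hmeas : Measurable fun ω => q ⬝ᵥ z ω := (measurable_dotProduct q).comp hz.measurable
  have : IsProbabilityMeasure (P.map (fun ω => q ⬝ᵥ z ω)) :=
    Measure.isProbabilityMeasure_map hmeas.aemeasurable
  rw [gaussianReal_map_const_mul]
  refine Measure.ext_of_charFun ?_
  have h := hind.charFun_map_fun_sum_eq_prod fun j => ((hzj j).const_mul (q j)).aemeasurable
  change charFun (P.map (fun ω => ∑ j, q j * z ω j)) = _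
  rw [h]
  ext t
  simp only [Finset.prod_apply, hlaw, charFun_gaussianReal]
  rw [← Complex.exp_sum]
  congr 1
  have hsum : ((σ * √(q ⬝ᵥ q)) ^ 2 : ℝ) = ∑ j, q j ^ 2 * σ ^ 2 := by
    rw [mul_pow, Real.sq_sqrt hq0, dotProduct, Finset.mul_sum]
    exact Finset.sum_congr rfl fun j _ => by ring
  simp only [NNReal.coe_mul, NNReal.coe_mk, Real.coe_toNNReal _ (sq_nonneg σ), hsum, mul_one]
  push_cast
  rw [Finset.sum_mul, Finset.sum_div]
  simp [Finset.sum_neg_distrib]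

/-- Shrinking `q` only lowers the tail. Writing the law as a scaled standard Gaussian covers `q = 0`
without a separate case. -/
theorem IsGaussianNoise.abs_dotProduct_tail_le {Ω : Type*} [MeasurableSpace Ω] {P : Measure Ω}
    [IsProbabilityMeasure P] {m : ℕ} {σ : ℝ} {z : Ω → Fin m → ℝ} (hz : IsGaussianNoise P σ z)
    (hσ : 0 < σ) {q : Fin m → ℝ} (hq : q ⬝ᵥ q ≤ 1) {t : ℝ} (ht : 0 < t) :
    P.real {ω | t * σ < |q ⬝ᵥ z ω|} ≤ 2 * (Real.exp (-t ^ 2 / 2) / (t * √(2 * Real.pi))) := by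
  have hmeas : Measurable fun ω => q ⬝ᵥ z ω := (measurable_dotProduct q).comp hz.measurable
  have hset : MeasurableSet {y : ℝ | t * σ < |y|} := measurableSet_lt measurable_const (by fun_prop)
  have h : P.real {ω | t * σ < |q ⬝ᵥ z ω|} =
      (gaussianReal 0 1).real {y | t * σ < |σ * √(q ⬝ᵥ q) * y|} := by
    have h1 := map_measureReal_apply (μ := P) hmeas hset
    rw [hz.map_dotProduct q, map_measureReal_apply (measurable_const_mul _) hset] at h1
    exact h1.symm
  rw [h]
  refine (measureReal_mono ?_).trans (gaussianReal_abs_tail_le ht)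
  intro y hy
  have hy' : t * σ < |σ * √(q ⬝ᵥ q) * y| := hy
  rw [abs_mul, abs_mul, abs_of_pos hσ, abs_of_nonneg (Real.sqrt_nonneg _), mul_comm t,
    mul_assoc] at hy'
  have h2 : √(q ⬝ᵥ q) ≤ 1 := Real.sqrt_le_one.mpr hq
  exact (lt_of_mul_lt_mul_left hy' hσ.le).trans_le (mul_le_of_le_one_left (abs_nonneg y) h2)

/-! ### Random signs -/

/-- The sign vectors on `J`: they take the values `± 1` on `J` and vanish off `J`. -/
noncomputable def signPatterns {N : ℕ} (J : Finset (Fin N)) : Finset (Fin N → ℝ) :=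
  Fintype.piFinset fun i => if i ∈ J then {1, -1} else {0}

theorem mem_signPatterns {N : ℕ} {J : Finset (Fin N)} {s : Fin N → ℝ} :
    s ∈ signPatterns J ↔ (∀ i ∈ J, s i = 1 ∨ s i = -1) ∧ ∀ i ∉ J, s i = 0 := by
  rw [signPatterns, Fintype.mem_piFinset, ← forall_and]
  refine forall_congr' fun i => ?_
  by_cases hi : i ∈ J <;> simp [hi]

theorem card_signPatterns {N : ℕ} (J : Finset (Fin N)) : (signPatterns J).card = 2 ^ J.card := by
  have h (i : Fin N) : (if i ∈ J then ({1, -1} : Finset ℝ) else {0}).card =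
      if i ∈ J then 2 else 1 := by
    split_ifs
    · exact Finset.card_pair (by norm_num)
    · simp
  rw [signPatterns, Fintype.card_piFinset]
  simp_rw [h]
  simp

/-- The sum factors over coordinates, each factor on `J` being `2 cosh (w i) ≤ 2 exp (w i ^ 2 / 2)`;
off `J` the only value is `0`. -/
theorem sum_signPatterns_exp_le {N : ℕ} (J : Finset (Fin N)) (w : Fin N → ℝ) :
    ∑ s ∈ signPatterns J, Real.exp (w ⬝ᵥ s) ≤ 2 ^ J.card * Real.exp (w ⬝ᵥ w / 2) := by
  have h1 : ∑ s ∈ signPatterns J, Real.exp (w ⬝ᵥ s) =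
      ∏ i, ∑ c ∈ (if i ∈ J then ({1, -1} : Finset ℝ) else {0}), Real.exp (w i * c) := by
    rw [Finset.prod_univ_sum, signPatterns]
    exact Finset.sum_congr rfl fun s _ => by rw [dotProduct, Real.exp_sum]
  have h2 (i : Fin N) : ∑ c ∈ (if i ∈ J then ({1, -1} : Finset ℝ) else {0}),
      Real.exp (w i * c) ≤ (if i ∈ J then 2 else 1) * Real.exp (w i * w i / 2) := by
    split_ifs
    · rw [Finset.sum_pair (by norm_num), mul_one, mul_neg_one, ← sq]
      have := Real.cosh_le_exp_half_sq (w i)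
      rw [Real.cosh_eq] at this
      linarith
    · simp only [Finset.sum_singleton, mul_zero, one_mul]
      gcongr
      exact div_nonneg (mul_self_nonneg _) zero_le_two
  rw [h1]
  refine (Finset.prod_le_prod (fun i _ => Finset.sum_nonneg fun c _ => (Real.exp_pos _).le)
    fun i _ => h2 i).trans_eq ?_
  rw [Finset.prod_mul_distrib, ← Real.exp_sum, dotProduct, Finset.sum_div]
  simp

/-- Hoeffding's inequality for uniformly distributed signs. -/
theorem card_signPatterns_tail_le {N : ℕ} (J : Finset (Fin N)) (w : Fin N → ℝ) {t V : ℝ}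
    (ht : 0 ≤ t) (hV : 0 < V) (hw : w ⬝ᵥ w ≤ V) :
    (((signPatterns J).filter fun s => t < |w ⬝ᵥ s|).card : ℝ) ≤
      2 * 2 ^ J.card * Real.exp (-t ^ 2 / (2 * V)) := by
  -- The optimal Chernoff parameter, minimizing `l² V / 2 - l t`.
  set l : ℝ := t / V with hl
  have hl0 : 0 ≤ l := by positivity
  have hone (c : ℝ) (hc : c ^ 2 = l ^ 2) : ∑ s ∈ signPatterns J, Real.exp ((c • w) ⬝ᵥ s) ≤
      2 ^ J.card * Real.exp (l ^ 2 * V / 2) := by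
    refine (sum_signPatterns_exp_le J (c • w)).trans ?_
    rw [smul_dotProduct, dotProduct_smul, smul_eq_mul, smul_eq_mul, ← mul_assoc, ← sq, hc]
    gcongr
  have hsum : (((signPatterns J).filter fun s => t < |w ⬝ᵥ s|).card : ℝ) * Real.exp (l * t) ≤
      ∑ s ∈ signPatterns J, (Real.exp ((l • w) ⬝ᵥ s) + Real.exp ((-l • w) ⬝ᵥ s)) := by
    rw [← nsmul_eq_mul, ← Finset.sum_const]
    refine (Finset.sum_le_sum fun s hs => ?_).trans
      (Finset.sum_le_sum_of_subset_of_nonneg (Finset.filter_subset _ _)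
        fun s _ _ => by positivity)
    have hs' := (Finset.mem_filter.mp hs).2
    simp only [smul_dotProduct, smul_eq_mul]
    rcases lt_abs.mp hs' with h | h
    · have : Real.exp (l * t) ≤ Real.exp (l * (w ⬝ᵥ s)) := by gcongr
      linarith [Real.exp_pos (-l * (w ⬝ᵥ s))]
    · have : Real.exp (l * t) ≤ Real.exp (-l * (w ⬝ᵥ s)) := by
        rw [neg_mul, ← mul_neg]; gcongr
      linarith [Real.exp_pos (l * (w ⬝ᵥ s))]
  rw [Finset.sum_add_distrib] at hsum
  have h := hsum.trans (add_le_add (hone l rfl) (hone (-l) (neg_sq l)))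
  have e : Real.exp (l ^ 2 * V / 2) = Real.exp (-t ^ 2 / (2 * V)) * Real.exp (l * t) := by
    rw [← Real.exp_add]; congr 1; rw [hl]; field_simp; ring
  rw [e] at h
  refine le_of_mul_le_mul_right (h.trans_eq ?_) (Real.exp_pos (l * t))
  ring

theorem measurable_real_sign : Measurable Real.sign :=
  Measurable.ite measurableSet_Iio measurable_const
    (Measurable.ite measurableSet_Ioi measurable_const measurable_const)

/-- The failure probability of the sign condition, in the nontrivial range of `ε`. -/
theorem sign_failure_bound {N ε : ℝ} (hN : 0 < N) (hε : 0 < ε)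
    (ha : 1 < 0.15 * Real.log (2 * N / ε)) :
    0 < Real.log (N / (2 * ε)) ∧
      N * (2 * Real.exp (-(0.29 : ℝ) ^ 2 / (2 * (1 / (32 * Real.log (N / (2 * ε)))))))  ≤ ε := by
  set L := Real.log (N / (2 * ε)) with hL
  have h4 : Real.log 4 = 2 * Real.log 2 := by
    rw [show (4 : ℝ) = 2 ^ 2 by norm_num, Real.log_pow]; norm_num
  have hlog : Real.log (2 * N / ε) = L + Real.log 4 := by
    rw [hL, ← Real.log_mul (by positivity) (by norm_num)]
    congr 1; field_simp; norm_num
  have h2 := Real.log_two_lt_d9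
  -- `1 / 0.15 - log 4` is about `5.28`.
  have hL5 : 5.2 < L := by
    rw [hlog, h4] at ha; norm_num at ha h2 ⊢; linarith
  refine ⟨by linarith, ?_⟩
  have hNe : N = 2 * ε * Real.exp L := by
    rw [hL, Real.exp_log (by positivity)]; field_simp
  -- `16 * 0.29 ^ 2 = 1.3456`: one factor `exp (-L)` cancels `N / (2 * ε)`, and the excess `0.3456 *
  -- L > log 4` pays for the remaining factor `4`.
  have he : -(0.29 : ℝ) ^ 2 / (2 * (1 / (32 * L))) = -L + -(0.3456 * L) := by
    have : L ≠ 0 := by linarith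
    field_simp; norm_num
  have h3 : Real.exp (-(0.3456 * L)) ≤ 1 / 4 := by
    rw [← Real.exp_log (show (0 : ℝ) < 1 / 4 by norm_num), Real.exp_le_exp, one_div,
      Real.log_inv, h4]
    norm_num at h2 hL5 ⊢; linarith
  have h5 : Real.exp L * Real.exp (-L) = 1 := by rw [← Real.exp_add]; simp
  calc N * (2 * Real.exp (-(0.29 : ℝ) ^ 2 / (2 * (1 / (32 * L)))))
      = 4 * ε * (Real.exp L * Real.exp (-L)) * Real.exp (-(0.3456 * L)) := by
        rw [he, Real.exp_add]; nth_rewrite 1 [hNe]; ring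
    _ ≤ 4 * ε * 1 * (1 / 4) := by rw [h5]; gcongr
    _ = ε := by ring

/-- Most sign patterns satisfy the dual certificate condition for given coefficient vectors. -/
theorem card_good_signs_ge {N : ℕ} (J : Finset (Fin N)) (w : Fin N → Fin N → ℝ) {t V ε : ℝ}
    (ht : 0 ≤ t) (hV : 0 < V) (hw : ∀ i ∉ J, w i ⬝ᵥ w i ≤ V)
    (hε : N * (2 * Real.exp (-t ^ 2 / (2 * V))) ≤ ε) :
    (1 - ε) * 2 ^ J.card ≤
      (((signPatterns J).filter fun s => ∀ i ∉ J, |w i ⬝ᵥ s| ≤ t).card : ℝ) := by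
  classical
  have hbad : (((signPatterns J).filter fun s => ¬ ∀ i ∉ J, |w i ⬝ᵥ s| ≤ t).card : ℝ) ≤
      ε * 2 ^ J.card := by
    have hsub : ((signPatterns J).filter fun s => ¬ ∀ i ∉ J, |w i ⬝ᵥ s| ≤ t) ⊆
        Jᶜ.biUnion fun i => (signPatterns J).filter fun s => t < |w i ⬝ᵥ s| := by
      intro s hs
      rw [Finset.mem_filter] at hs
      obtain ⟨hs, h⟩ := hs
      push Not at h
      obtain ⟨i, hi, h⟩ := h
      exact Finset.mem_biUnion.mpr ⟨i, by simpa using hi, Finset.mem_filter.mpr ⟨hs, h⟩⟩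
    calc (((signPatterns J).filter fun s => ¬ ∀ i ∉ J, |w i ⬝ᵥ s| ≤ t).card : ℝ)
        ≤ ∑ i ∈ Jᶜ, (((signPatterns J).filter fun s => t < |w i ⬝ᵥ s|).card : ℝ) := by
          exact_mod_cast (Finset.card_le_card hsub).trans Finset.card_biUnion_le
      _ ≤ ∑ i ∈ Jᶜ, 2 * 2 ^ J.card * Real.exp (-t ^ 2 / (2 * V)) :=
          Finset.sum_le_sum fun i hi =>
            card_signPatterns_tail_le J (w i) ht hV (hw i (by simpa using hi))
      _ ≤ N * (2 * 2 ^ J.card * Real.exp (-t ^ 2 / (2 * V))) := by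
          rw [Finset.sum_const, nsmul_eq_mul]
          gcongr
          simpa using Finset.card_le_univ (Jᶜ)
      _ = N * (2 * Real.exp (-t ^ 2 / (2 * V))) * 2 ^ J.card := by ring
      _ ≤ ε * 2 ^ J.card := by gcongr
  have hadd := Finset.card_filter_add_card_filter_not (s := signPatterns J)
    (fun s => ∀ i ∉ J, |w i ⬝ᵥ s| ≤ t)
  rw [card_signPatterns] at hadd
  have hadd' : (((signPatterns J).filter fun s => ∀ i ∉ J, |w i ⬝ᵥ s| ≤ t).card : ℝ) +
      (((signPatterns J).filter fun s => ¬ ∀ i ∉ J, |w i ⬝ᵥ s| ≤ t).card : ℝ) =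
      2 ^ J.card := by exact_mod_cast hadd
  linarith

/-- Simultaneous control of `N` linear functionals of the noise. -/
theorem IsGaussianNoise.forall_abs_dotProduct_le {Ω : Type*} [MeasurableSpace Ω] {P : Measure Ω}
    [IsProbabilityMeasure P] {m N : ℕ} {σ : ℝ} {z : Ω → Fin m → ℝ} (hz : IsGaussianNoise P σ z)
    (hσ : 0 < σ) (hN : 2 ≤ N) (q : Fin N → Fin m → ℝ) (hq : ∀ i, q i ⬝ᵥ q i ≤ 1) :
    1 - 1 / (N * √(2 * Real.pi * Real.log N)) ≤
      P.real (z ⁻¹' {v | ∀ i, |q i ⬝ᵥ v| ≤ 2 * √(Real.log N) * σ}) := by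
  have hN' : (2 : ℝ) ≤ N := by exact_mod_cast hN
  have hlog : 0 < Real.log N := Real.log_pos (by linarith)
  have ht : 0 < 2 * √(Real.log N) := by positivity
  have hdot (i : Fin N) : Measurable fun v : Fin m → ℝ => q i ⬝ᵥ v :=
    measurable_dotProduct (q i)
  have hmeas : MeasurableSet {v | ∀ i, |q i ⬝ᵥ v| ≤ 2 * √(Real.log N) * σ} := by
    rw [Set.ofPred_forall]
    exact MeasurableSet.iInter fun i =>
      measurableSet_le (continuous_abs.measurable.comp (hdot i)) measurable_const
  have hcompl : (z ⁻¹' {v | ∀ i, |q i ⬝ᵥ v| ≤ 2 * √(Real.log N) * σ})ᶜ =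
      ⋃ i, {ω | 2 * √(Real.log N) * σ < |q i ⬝ᵥ z ω|} := by
    ext ω; simp
  have hbad : P.real (z ⁻¹' {v | ∀ i, |q i ⬝ᵥ v| ≤ 2 * √(Real.log N) * σ})ᶜ ≤
      1 / (N * √(2 * Real.pi * Real.log N)) := by
    rw [hcompl]
    refine (measureReal_iUnion_fintype_le _).trans ((Finset.sum_le_sum fun i _ =>
      hz.abs_dotProduct_tail_le hσ (hq i) ht).trans_eq ?_)
    -- Each tail carries `N⁻²`, so the union over `N` functionals leaves `1 / N`.
    have he : Real.exp (-(2 * √(Real.log N)) ^ 2 / 2) = ((N : ℝ) ^ 2)⁻¹ := by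
      rw [mul_pow, Real.sq_sqrt hlog.le,
        show -(2 ^ 2 * Real.log N) / 2 = -(Real.log N + Real.log N) by ring, Real.exp_neg,
        Real.exp_add, Real.exp_log (by linarith), sq]
    rw [he, Real.sqrt_mul (by positivity : 0 ≤ 2 * Real.pi), Finset.sum_const, Finset.card_univ, Fintype.card_fin,
      nsmul_eq_mul]
    have : √(Real.log N) ≠ 0 := by positivity
    have : √(2 * Real.pi) ≠ 0 := by positivity
    field_simp
  rw [probReal_compl_eq_one_sub (hz.measurable hmeas)] at hbad
  linarith

/-! ### Counting supports and sign patterns -/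

/-- Under the generic signal model, every sign pattern on every `k`-subset has at least its
nominal probability. -/
theorem IsGenericSignal.sign_pattern_prob_ge {Ω : Type*} [MeasurableSpace Ω] {P : Measure Ω}
    [IsProbabilityMeasure P] {N k : ℕ} {x : Ω → Fin N → ℝ} (hx : IsGenericSignal P k x)
    (hsparse : ∀ᵐ ω ∂P, IsSparse k (x ω)) {J : Finset (Fin N)} (hJ : J.card = k)
    {s : Fin N → ℝ} (hs : s ∈ signPatterns J) :
    1 / (N.choose k * 2 ^ k : ℝ) ≤ P.real (x ⁻¹' {v | ∀ i, Real.sign (v i) = s i}) := by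
  classical
  obtain ⟨I, hI, -, hunif, hsign⟩ := hx.exists_support
  obtain ⟨hs1, hs0⟩ := mem_signPatterns.mp hs
  -- The model wants values `± 1` everywhere, so the pattern is filled with `1` off `J`, where it is
  -- not tested.
  have h := hsign J hJ (fun i => if i ∈ J then s i else 1) fun i => by
    by_cases hi : i ∈ J
    · simpa [hi] using hs1 i hi
    · simp [hi]
  rw [measureReal_def, cond_apply (hI J), ENNReal.toReal_mul, ENNReal.toReal_inv,
    ← measureReal_def, ← measureReal_def, hunif J hJ] at h
  have hchoose : (N.choose k : ℝ) ≠ 0 := by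
    have : k ≤ N := by rw [← hJ]; simpa using Finset.card_le_univ J
    exact_mod_cast (Nat.choose_pos this).ne'
  have h' : P.real ({ω | I ω = J} ∩
      {ω | ∀ i ∈ J, Real.sign (x ω i) = if i ∈ J then s i else 1}) =
      1 / (N.choose k * 2 ^ k : ℝ) := by
    rw [one_div, inv_inv] at h
    field_simp at h ⊢
    linarith
  rw [← h', measureReal_def, measureReal_def]
  refine ENNReal.toReal_mono (measure_ne_top _ _) (measure_mono_ae ?_)
  filter_upwards [hsparse] with ω hω hmem i
  have hsg : ∀ i ∈ J, Real.sign (x ω i) = s i := fun i hi => by simpa [hi] using hmem.2 i hi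
  by_cases hi : i ∈ J
  · exact hsg i hi
  -- Nonzero signs put `J` inside the support of `x`; sparsity then forces equality, so `x` vanishes
  -- off `J`.
  · have hsub : (J : Set (Fin N)) ⊆ {i | x ω i ≠ 0} := by
      intro j hj h0
      have h1 := hsg j hj
      rw [h0, Real.sign_zero] at h1
      rcases hs1 j hj with h2 | h2 <;> rw [h2] at h1 <;> norm_num at h1
    have heq := Set.eq_of_subset_of_ncard_le hsub
      (by rw [Set.ncard_coe_finset, hJ]; exact hω) (Set.toFinite _)
    have : x ω i = 0 := by
      by_contra hne
      have : i ∈ (J : Set (Fin N)) := by rw [heq]; exact hne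
      exact hi this
    rw [this, Real.sign_zero, hs0 i hi]

/-- Both properties hold simultaneously for a `1 - 2ε` fraction of the `k`-subsets. -/
theorem card_filter_and_ge {N k : ℕ} (hk : k ≤ N) {A B : Finset (Fin N) → Prop} {ε : ℝ}
    (hA : 1 - ε ≤ uniformSubsetProb N k A) (hB : 1 - ε ≤ uniformSubsetProb N k B)
    {S : Finset (Finset (Fin N))}
    (hS : ∀ J, J.card = k → A J → B J → J ∈ S) : (1 - 2 * ε) * N.choose k ≤ S.card := by
  classical
  have hchoose : (0 : ℝ) < N.choose k := by exact_mod_cast Nat.choose_pos hk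
  rw [uniformSubsetProb, le_div_iff₀ hchoose] at hA hB
  set U := (Finset.univ : Finset (Fin N)).powersetCard k with hU
  have hUc : (U.card : ℝ) = N.choose k := by simp [hU]
  have hsub : U.filter A ∩ U.filter B ⊆ S := by
    intro J hJ
    simp only [Finset.mem_inter, Finset.mem_filter, hU, Finset.mem_powersetCard] at hJ
    exact hS J hJ.1.1.2 hJ.1.2 hJ.2.2
  have h1 := Finset.card_union_add_card_inter (U.filter A) (U.filter B)
  have h2 : (U.filter A ∪ U.filter B).card ≤ U.card :=
    Finset.card_le_card (Finset.union_subset (Finset.filter_subset _ _) (Finset.filter_subset _ _))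
  have h3 := Finset.card_le_card hsub
  have h4 : ((U.filter A).card : ℝ) + (U.filter B).card ≤ U.card + S.card := by
    exact_mod_cast (by omega : (U.filter A).card + (U.filter B).card ≤ U.card + S.card)
  have hA' : (1 - ε) * (N.choose k : ℝ) ≤ ((U.filter A).card : ℝ) := by convert! hA
  have hB' : (1 - ε) * (N.choose k : ℝ) ≤ ((U.filter B).card : ℝ) := by convert! hB
  linarith

/-! ### The good event and its probability -/

/-- The coefficients `w i` of the columns along the span of the columns in `J`. -/
theorem exists_certificate {m N : ℕ} {Φ : Matrix (Fin m) (Fin N) ℝ} (hΦ : UnitColumns Φ)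
    {J : Finset (Fin N)} {α : ℝ}
    (hrip : ‖(colSubmatrix Φ J)ᵀ * colSubmatrix Φ J - 1‖ ≤ 1 / 2)
    (hsinc : ∀ i : Fin N, i ∉ J → ‖WithLp.toLp 2 ((colSubmatrix Φ J)ᵀ *ᵥ Φ.col i)‖ ^ 2 ≤ α) :
    ∃ w : Fin N → Fin N → ℝ, (∀ i, ∀ j ∉ J, w i j = 0) ∧
      (∀ i, ∀ j ∈ J, Φ.col j ⬝ᵥ (Φ.col i - Φ *ᵥ w i) = 0) ∧
      (∀ i ∉ J, w i ⬝ᵥ w i ≤ 4 * α) ∧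
      ∀ i, (Φ.col i - Φ *ᵥ w i) ⬝ᵥ (Φ.col i - Φ *ᵥ w i) ≤ 1 := by
  choose w h1 h2 h3 using fun i => (exists_projection_coeffs Φ J hrip).2 (Φ.col i)
  refine ⟨w, h1, h2, fun i hi => (h3 i).trans (by linarith [hsinc i hi]), fun i => ?_⟩
  refine (residual_dotProduct_self_le Φ J (Φ.col i) (w i) (h1 i) (h2 i)).trans ?_
  rw [← norm_toLp_sq, hΦ i, one_pow]

/-- For a good support there are many sign patterns, and a likely set of noise vectors, for which
the Lasso satisfies the prediction bound. -/
theorem exists_good_signs_and_noise {Ω : Type*} [MeasurableSpace Ω] {P : Measure Ω}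
    [IsProbabilityMeasure P] {m N : ℕ} {Φ : Matrix (Fin m) (Fin N) ℝ} (hΦ : UnitColumns Φ)
    {σ : ℝ} {z : Ω → Fin m → ℝ} (hz : IsGaussianNoise P σ z) (hσ : 0 < σ) (hN : 2 ≤ N)
    {ε : ℝ} (hε : 0 < ε) (ha : 1 < 0.15 * Real.log (2 * N / ε)) (J : Finset (Fin N))
    (hrip : ‖(colSubmatrix Φ J)ᵀ * colSubmatrix Φ J - 1‖ ≤ 1 / 2)
    (hsinc : ∀ i : Fin N, i ∉ J → ‖WithLp.toLp 2 ((colSubmatrix Φ J)ᵀ *ᵥ Φ.col i)‖ ^ 2 ≤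
      1 / (128 * Real.log (N / (2 * ε)))) :
    ∃ (S : Finset (Fin N → ℝ)) (G : Set (Fin m → ℝ)), S ⊆ signPatterns J ∧ MeasurableSet G ∧
      (1 - ε) * 2 ^ J.card ≤ (S.card : ℝ) ∧
      1 - 1 / (N * √(2 * Real.pi * Real.log N)) ≤ P.real (z ⁻¹' G) ∧
      ∀ (v u : Fin N → ℝ) (e : Fin m → ℝ), (fun i => Real.sign (v i)) ∈ S → e ∈ G →
        IsLassoEstimate Φ (2 * √(2 * Real.log N) * σ) (Φ *ᵥ v + e) u →
        ‖WithLp.toLp 2 (Φ *ᵥ v - Φ *ᵥ u)‖ ^ 2 ≤ 200 * J.card * Real.log N * σ ^ 2 := by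
  classical
  have hN' : (2 : ℝ) ≤ N := by exact_mod_cast hN
  have hlog : 0 < Real.log N := Real.log_pos (by linarith)
  obtain ⟨w, hw0, hworth, hwle, hqle⟩ := exists_certificate hΦ hrip hsinc
  obtain ⟨hL, hfail⟩ := sign_failure_bound (by linarith : (0 : ℝ) < N) hε ha
  set T : ℝ := 2 * √(Real.log N) * σ with hT
  -- Columns on `J` and residuals off `J` form a single family of `N` functionals, so only one union
  -- bound is spent.
  set q : Fin N → Fin m → ℝ := fun i => if i ∈ J then Φ.col i else Φ.col i - Φ *ᵥ w i with hq
  have hq1 (i : Fin N) : q i ⬝ᵥ q i ≤ 1 := by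
    by_cases hi : i ∈ J
    · simp only [hq, hi, if_true]
      rw [← norm_toLp_sq, hΦ i, one_pow]
    · simpa only [hq, hi, if_false] using hqle i
  -- Since `τ = √2 * T`, the certificate needs a threshold at most `1 - 1 / √2`, about `0.2929`.
  refine ⟨(signPatterns J).filter fun s => ∀ i ∉ J, |w i ⬝ᵥ s| ≤ 0.29,
    {v | ∀ i, |q i ⬝ᵥ v| ≤ T}, Finset.filter_subset _ _, ?_, ?_, ?_, ?_⟩
  · rw [Set.ofPred_forall]
    exact MeasurableSet.iInter fun i => measurableSet_le
      (continuous_abs.measurable.comp (measurable_dotProduct (q i))) measurable_const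
  · refine card_good_signs_ge J w (by norm_num) (by positivity) (fun i hi => ?_) hfail
    refine (hwle i hi).trans_eq ?_
    field_simp
    norm_num
  · exact hz.forall_abs_dotProduct_le hσ hN q hq1
  · intro v u e hv he hu
    obtain ⟨hv, hvw⟩ := Finset.mem_filter.mp hv
    have hv0 := (mem_signPatterns.mp hv).2
    have hτT : 2 * √(2 * Real.log N) * σ = √2 * T := by
      rw [Real.sqrt_mul (by norm_num), hT]; ring
    have hT0 : 0 ≤ T := by positivity
    have hs2 : √2 * √2 = 2 := Real.mul_self_sqrt (by norm_num)
    have hs2u : √2 ≤ 1.4143 := by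
      rw [Real.sqrt_le_left (by norm_num)]; norm_num
    have hs2l : 1.414 ≤ √2 := Real.le_sqrt_of_sq_le (by norm_num)
    rw [hτT] at hu
    have h := hu.prediction_bound (T := T) (by positivity) J
      (fun i hi => Real.sign_eq_zero_iff.mp (hv0 i hi)) (exists_projection_coeffs Φ J hrip).1
      w hw0 hworth (fun j hj => by simpa [hq, hj] using he j) (fun i hi => by
        have h1 : |(Φ.col i - Φ *ᵥ w i) ⬝ᵥ e| ≤ T := by simpa [hq, hi] using he i
        have h2 : √2 * T * |w i ⬝ᵥ fun j => Real.sign (v j)| ≤ √2 * T * 0.29 := by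
          gcongr; exact hvw i hi
        have h3 : T * 1.4 ≤ T * (√2 * 0.71 + 0.4) := by gcongr; linarith
        linarith)
    refine h.trans ?_
    have hTsq : T ^ 2 = 4 * Real.log N * σ ^ 2 := by
      rw [hT, mul_pow, mul_pow, Real.sq_sqrt hlog.le]; ring
    -- `4 * (1 + √2) ^ 2` is about `23.3`; with the factor `8` this gives `200`.
    have h4 : (T + √2 * T) ^ 2 ≤ 25 * Real.log N * σ ^ 2 := by
      have : (T + √2 * T) ^ 2 = (3 + 2 * √2) * T ^ 2 := by
        linear_combination T ^ 2 * hs2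
      rw [this, hTsq]
      have h0 : 0 ≤ Real.log N * σ ^ 2 := by positivity
      nlinarith
    calc 8 * (J.card : ℝ) * (T + √2 * T) ^ 2 ≤ 8 * J.card * (25 * Real.log N * σ ^ 2) := by gcongr
      _ = 200 * J.card * Real.log N * σ ^ 2 := by ring

/-- Lower bound for the probability that the pair (signal, noise) is good. -/
theorem prob_good_pairs_ge {Ω : Type*} [MeasurableSpace Ω] {P : Measure Ω}
    [IsProbabilityMeasure P] {m N k : ℕ} (hk : k ≤ N) {x : Ω → Fin N → ℝ} {z : Ω → Fin m → ℝ}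
    (hx : IsGenericSignal P k x) (hsparse : ∀ᵐ ω ∂P, IsSparse k (x ω))
    (hz : Measurable z) (hind : IndepFun x z P)
    {ε δ : ℝ} (hε : 0 ≤ ε) (hδ : 0 ≤ δ) (hεδ : 0 ≤ 1 - 3 * ε - δ)
    (U : Finset (Finset (Fin N))) (hU : ∀ J ∈ U, J.card = k)
    (hUcard : (1 - 2 * ε) * N.choose k ≤ U.card)
    (S : Finset (Fin N) → Finset (Fin N → ℝ)) (hS : ∀ J ∈ U, S J ⊆ signPatterns J)
    (hScard : ∀ J ∈ U, (1 - ε) * 2 ^ k ≤ ((S J).card : ℝ))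
    (G : Finset (Fin N) → Set (Fin m → ℝ)) (hG : ∀ J ∈ U, MeasurableSet (G J))
    (hGprob : ∀ J ∈ U, 1 - δ ≤ P.real (z ⁻¹' G J)) :
    1 - 3 * ε - δ ≤
      P.real {ω | ∃ J ∈ U, (fun i => Real.sign (x ω i)) ∈ S J ∧ z ω ∈ G J} := by
  classical
  set B : (Fin N → ℝ) → Set (Fin N → ℝ) := fun s => {v | ∀ i, Real.sign (v i) = s i} with hB
  have hBm (s : Fin N → ℝ) : MeasurableSet (B s) := by
    simp only [hB, Set.ofPred_forall]
    exact MeasurableSet.iInter fun i =>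
      (measurable_real_sign.comp (measurable_pi_apply i)) (measurableSet_singleton (s i))
  set E : (Σ _ : Finset (Fin N), Fin N → ℝ) → Set Ω :=
    fun p => x ⁻¹' B p.2 ∩ z ⁻¹' G p.1 with hE
  have hset : {ω | ∃ J ∈ U, (fun i => Real.sign (x ω i)) ∈ S J ∧ z ω ∈ G J} =
      ⋃ p ∈ U.sigma S, E p := by
    ext ω
    simp only [Set.mem_ofPred_eq, Set.mem_iUnion, Finset.mem_sigma, exists_prop, hE,
      Set.mem_inter_iff, Set.mem_preimage, hB]
    constructor
    · rintro ⟨J, hJ, hs, hg⟩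
      exact ⟨⟨J, fun i => Real.sign (x ω i)⟩, ⟨hJ, hs⟩, fun i => rfl, hg⟩
    · rintro ⟨⟨J, s⟩, ⟨hJ, hs⟩, hxs, hg⟩
      exact ⟨J, hJ, by rwa [show (fun i => Real.sign (x ω i)) = s from funext hxs], hg⟩
  have hdisj : Set.PairwiseDisjoint (↑(U.sigma S)) E := by
    rintro ⟨J, s⟩ hp ⟨J', s'⟩ hp' hne
    rw [Function.onFun, Set.disjoint_left]
    rintro ω ⟨h1, -⟩ ⟨h2, -⟩
    have hp1 := Finset.mem_sigma.mp hp
    have hp2 := Finset.mem_sigma.mp hp'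
    have hss : s = s' := funext fun i => (h1 i).symm.trans (h2 i)
    subst hss
    -- A sign pattern determines its `J` as its support, so the events for distinct pairs are
    -- disjoint.
    have hsupp : ∀ K : Finset (Fin N), s ∈ signPatterns K → ∀ i, i ∈ K ↔ s i ≠ 0 := by
      intro K hK i
      obtain ⟨ha, hb⟩ := mem_signPatterns.mp hK
      refine ⟨fun hi => ?_, fun hi => by_contra fun hn => hi (hb i hn)⟩
      rcases ha i hi with h | h <;> rw [h] <;> norm_num
    have hJJ : J = J' := by
      ext i
      rw [hsupp J (hS J hp1.1 hp1.2), hsupp J' (hS J' hp2.1 hp2.2)]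
    subst hJJ
    exact hne rfl
  have hEm : ∀ p ∈ U.sigma S, MeasurableSet (E p) := fun p hp =>
    (hx.measurable (hBm p.2)).inter (hz (hG p.1 (Finset.mem_sigma.mp hp).1))
  have hδ1 : 0 ≤ 1 - δ := by linarith
  have hEprob : ∀ p ∈ U.sigma S, 1 / (N.choose k * 2 ^ k : ℝ) * (1 - δ) ≤ P.real (E p) := by
    intro p hp
    have hp1 := Finset.mem_sigma.mp hp
    have h1 : P.real (E p) = P.real (x ⁻¹' B p.2) * P.real (z ⁻¹' G p.1) := by
      simp only [measureReal_def, hE]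
      rw [hind.measure_inter_preimage_eq_mul _ _ (hBm p.2) (hG p.1 hp1.1), ENNReal.toReal_mul]
    rw [h1]
    exact mul_le_mul (hx.sign_pattern_prob_ge hsparse (hU p.1 hp1.1) (hS p.1 hp1.1 hp1.2))
      (hGprob p.1 hp1.1) hδ1 measureReal_nonneg
  rw [hset, measureReal_biUnion_finset hdisj hEm]
  have hchoose : (0 : ℝ) < N.choose k := by exact_mod_cast Nat.choose_pos hk
  have hcount : (1 - 2 * ε) * N.choose k * ((1 - ε) * 2 ^ k) ≤ ((U.sigma S).card : ℝ) := by
    rw [Finset.card_sigma, Nat.cast_sum]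
    have h1 : (0 : ℝ) ≤ (1 - ε) * 2 ^ k := mul_nonneg (by linarith) (by positivity)
    calc (1 - 2 * ε) * N.choose k * ((1 - ε) * 2 ^ k) ≤ U.card * ((1 - ε) * 2 ^ k) := by gcongr
      _ = ∑ J ∈ U, (1 - ε) * 2 ^ k := by rw [Finset.sum_const, nsmul_eq_mul]
      _ ≤ ∑ J ∈ U, ((S J).card : ℝ) := Finset.sum_le_sum hScard
  calc 1 - 3 * ε - δ ≤ (1 - 2 * ε) * (1 - ε) * (1 - δ) := by
        nlinarith [mul_nonneg hε hδ, mul_nonneg (mul_nonneg hε hε) hδ1]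
    _ = (1 - 2 * ε) * N.choose k * ((1 - ε) * 2 ^ k) *
        (1 / (N.choose k * 2 ^ k : ℝ) * (1 - δ)) := by field_simp
    _ ≤ (U.sigma S).card * (1 / (N.choose k * 2 ^ k : ℝ) * (1 - δ)) := by gcongr
    _ = ∑ p ∈ U.sigma S, 1 / (N.choose k * 2 ^ k : ℝ) * (1 - δ) := by
        rw [Finset.sum_const, nsmul_eq_mul]
    _ ≤ ∑ p ∈ U.sigma S, P.real (E p) := Finset.sum_le_sum hEprob

end SparseRecovery

theorem mainTheorem4 :
    ∃ C₀ : ℝ, 0 < C₀ ∧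
      ∀ (c₀ : ℝ), 0 < c₀ →
      ∀ (m N k : ℕ), 2 ≤ N → k ≤ N →
      ∀ (ε σ : ℝ), 0 < ε → 0 < σ →
      ∀ (Φ : Matrix (Fin m) (Fin N) ℝ), SparseRecovery.UnitColumns Φ →
        (k : ℝ) ≤ c₀ * N / (‖Φ‖ ^ 2 * Real.log N) →
        SparseRecovery.IsStRIP Φ k (1 / 2) ε →
        SparseRecovery.IsSINC Φ k (1 / (128 * Real.log (N / (2 * ε)))) ε →
      ∀ {Ω : Type*} [MeasurableSpace Ω] (P : Measure Ω) [IsProbabilityMeasure P]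
        (x : Ω → Fin N → ℝ) (z : Ω → Fin m → ℝ) (xhat : Ω → Fin N → ℝ),
        SparseRecovery.IsGenericSignal P k x →
        (∀ᵐ ω ∂P, SparseRecovery.IsSparse k (x ω)) →
        SparseRecovery.IsGaussianNoise P σ z →
        IndepFun x z P →
        (∀ᵐ ω ∂P, SparseRecovery.IsLassoEstimate Φ (2 * √(2 * Real.log N) * σ)
          (Φ *ᵥ x ω + z ω) (xhat ω)) →
        1 - 3 * ε - 1 / (N * √(2 * Real.pi * Real.log N))
            - (N : ℝ) ^ (-(0.15 * Real.log (2 * N / ε) - 1)) ≤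
          P.real {ω | ‖WithLp.toLp 2 (Φ *ᵥ x ω - Φ *ᵥ xhat ω)‖ ^ 2
            ≤ C₀ * k * Real.log N * σ ^ 2} := by
  classical
  refine ⟨200, by norm_num, ?_⟩
  intro c₀ _ m N k hN hk ε σ hε hσ Φ hΦ _ hrip hsinc Ω _ P _ x z xhat hx hsparse hz hind hlasso
  have hN' : (2 : ℝ) ≤ N := by exact_mod_cast hN
  have hlog : 0 < Real.log N := Real.log_pos (by linarith)
  set δ : ℝ := 1 / (N * √(2 * Real.pi * Real.log N)) with hδ
  have hδ0 : 0 ≤ δ := by positivity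
  have hpow : 0 < (N : ℝ) ^ (-(0.15 * Real.log (2 * N / ε) - 1)) :=
    Real.rpow_pos_of_pos (by linarith) _
  rcases le_or_gt (1 - 3 * ε - δ - (N : ℝ) ^ (-(0.15 * Real.log (2 * N / ε) - 1))) 0 with h | h
  · exact h.trans measureReal_nonneg
  -- If `a ≤ 0` then `N ^ (-a) ≥ 1`, contradicting positivity of the claimed bound.
  have ha : 1 < 0.15 * Real.log (2 * N / ε) := by
    by_contra! hle
    have := Real.one_le_rpow (by linarith : (1 : ℝ) ≤ N)
      (by linarith : 0 ≤ -(0.15 * Real.log (2 * N / ε) - 1))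
    linarith
  set U : Finset (Finset (Fin N)) := Finset.univ.filter fun J => J.card = k ∧
    ‖(SparseRecovery.colSubmatrix Φ J)ᵀ * SparseRecovery.colSubmatrix Φ J - 1‖ ≤ 1 / 2 ∧
    ∀ i : Fin N, i ∉ J →
      ‖WithLp.toLp 2 ((SparseRecovery.colSubmatrix Φ J)ᵀ *ᵥ Φ.col i)‖ ^ 2 ≤
        1 / (128 * Real.log (N / (2 * ε))) with hU
  have hUcard : (1 - 2 * ε) * N.choose k ≤ U.card :=
    SparseRecovery.card_filter_and_ge hk hrip hsinc fun J h1 h2 h3 =>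
      Finset.mem_filter.mpr ⟨Finset.mem_univ J, h1, h2, h3⟩
  have hgood (J : Finset (Fin N)) (hJ : J ∈ U) :=
    SparseRecovery.exists_good_signs_and_noise hΦ hz hσ hN hε ha J
      (Finset.mem_filter.mp hJ).2.2.1 (Finset.mem_filter.mp hJ).2.2.2
  have hUk (J : Finset (Fin N)) (hJ : J ∈ U) : J.card = k := (Finset.mem_filter.mp hJ).2.1
  choose! S G hS hG hScard hGprob hbound using hgood
  have hprob := SparseRecovery.prob_good_pairs_ge hk hx hsparse hz.measurable hind hε.le hδ0
    (by linarith) U hUk hUcard S hS (fun J hJ => by simpa [hUk J hJ] using hScard J hJ) G hG hGprob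
  refine le_trans (by linarith) (hprob.trans ?_)
  rw [measureReal_def, measureReal_def]
  refine ENNReal.toReal_mono (measure_ne_top _ _) (measure_mono_ae ?_)
  filter_upwards [hlasso] with ω hω
  rintro ⟨J, hJ, hs, hg⟩
  have := hbound J hJ (x ω) (xhat ω) (z ω) hs hg hω
  rwa [hUk J hJ] at this
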